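/- Theorem 1. Consider a network with a source (node $0$), $N$ relays (nodes $1,\dots,N$) and a destination (node $N+1$), and let $1\le k\le N+1$. Node $i\le N$ has a link to each of the nodes $j=i+1,\dots,i+L_i$, where $L_i=\min(k,N+1-i)$. Let $d_{i,j}>0$ be the distances, $\eta\in\mathbb{R}$ the path loss exponent, $a_{i,j}\ge 0$ the power splitting parameters, with $\sum_{j=i+1}^{i+L_i}a_{i,j}=1$ for every $i\le N$, $P>0$ the transmit power, $\sigma^2>0$ the noise variance and $\gamma>0$ the SNR threshold. Let $H\subseteq\{1,\dots,N\}$ be the set of dual-mode relays. A network state $s_m$ consists of binary arrays $\beta_{i,m}[n]$ ($1\le i\le N$, $1\le n\le L_i$), which tell which buffer elements of relay $i$ hold a decoded signal, and of bits $\lambda_{i,m}$ ($i\in H$), which tell whether the dual-mode relay $i$ is active. For a link $i\to j$ put $$\mathbb{1}_{(i\to j),m}=\begin{cases}1,& i=0,\\ \beta_{i,m}[j-i]\,\lambda_{i,m},& i\in H,\\ \beta_{i,m}[j-i],&\text{otherwise,}\end{cases}$$ and put $\mathbb{1}_{(i\to j),m}=0$ if there is no link from $i$ to $j$. Let the complex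 fading coefficients $h_{i,j}$ of the links be independent, with every $|h_{i,j}|$ Rayleigh distributed with unit scale parameter (density $r e^{-r^2/2}$, $r\ge 0$). The outage probability at node $j$ in state $s_m$ is $P_o(j,m)=\mathbb{P}[\mathrm{SNR}_{j,m}<\gamma]$, where $$\mathrm{SNR}_{j,m}=\frac{P}{\sigma^2}\Big(\sum_{i=0}^{N}\mathbb{1}_{(i\to j),m}\,|h_{i,j}|\sqrt{d_{i,j}^{-\eta}a_{i,j}}\Big)^2 .$$ Then, for every link $i\to j$, the characteristic function of $|h_{i,j}|\sqrt{d_{i,j}^{-\eta}a_{i,j}}$ is $$\phi_{i,j}(t)=1+\mathrm{i}t\sqrt{\frac{2\pi a_{i,j}}{d_{i,j}^{\eta}}}\,\exp\Big(-\frac{a_{i,j}t^2}{2d_{i,j}^{\eta}}\Big)\,\Phi\Big(\mathrm{i}t\sqrt{\frac{a_{i,j}}{d_{i,j}^{\eta}}}\Big),\qquad t\in\mathbb{R},$$ where $\Phi$ is the entire function that extends the standard normal cdf, and for every state $s_m$ and every node $j\in\{1,\dots,N+1\}$ $$P_o(j,m)=\frac12-\frac1\pi\int_0^\infty\frac1t\,\operatorname{Im}\Big[\exp\Big(-\mathrm{i}t\sqrt{\frac{\gamma\sigma^2}{P}}\Big)\prod_{i=\max(0,j-k)}^{j-1}\phi_{i,j}(t)^{\mathbb{1}_{(i\to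 j),m}}\Big]dt,$$ where the integral is an improper (Riemann) integral $\lim_{T\to\infty}\int_0^T$, whose convergence is part of the claim. -/

import Mathlib

open MeasureTheory ProbabilityTheory Filter Topology

noncomputable section

/-! ## The Rayleigh distribution and the normal cdf at complex arguments -/

/-- The Rayleigh distribution with scale parameter `b`: the measure on `ℝ` with density
`(x / b²) exp (-x² / (2 b²))` on `[0, ∞)`. -/
def rayleighMeasure (b : ℝ) : Measure ℝ :=
  volume.withDensity fun x : ℝ =>
    ENNReal.ofReal (if 0 ≤ x then x / b ^ 2 * Real.exp (-(x ^ 2 / (2 * b ^ 2))) else 0)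

/-- The cdf `Φ` of the standard normal distribution, continued to an entire function:
`Φ(z) = 1/2 + (2π)^(-1/2) ∫_0^z exp (-w²/2) dw`, with the integral taken along the segment from
`0` to `z`. The two lemmas that follow (agreement with the cdf on the real line,
holomorphy on the whole plane) determine it uniquely. -/
def normalCDF (z : ℂ) : ℂ :=
  1 / 2 + 1 / (Real.sqrt (2 * Real.pi) : ℂ) *
    (z * ∫ u in (0 : ℝ)..1, Complex.exp (-(((u : ℂ) * z) ^ 2 / 2)))

theorem normalCDF_ofReal (x : ℝ) : normalCDF x = (cdf (gaussianReal 0 1) x : ℂ) := by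
  have hint := integrable_gaussianPDFReal 0 1
  have hc : ∀ y : ℝ, cdf (gaussianReal 0 1) y = ∫ t in Set.Iic y, gaussianPDFReal 0 1 t := by
    intro y
    rw [cdf_eq_real, measureReal_def, gaussianReal_apply_eq_integral _ one_ne_zero,
      ENNReal.toReal_ofReal]
    exact integral_nonneg fun t => gaussianPDFReal_nonneg 0 1 t
  have hsplit : (∫ t in Set.Iic x, gaussianPDFReal 0 1 t) =
      (∫ t in Set.Iic (0 : ℝ), gaussianPDFReal 0 1 t) + ∫ t in (0 : ℝ)..x, gaussianPDFReal 0 1 t := by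
    rw [← intervalIntegral.integral_Iic_sub_Iic hint.integrableOn hint.integrableOn]
    ring
  have hhalf : (∫ t in Set.Iic (0 : ℝ), gaussianPDFReal 0 1 t) = 1 / 2 := by
    have h1 : (∫ t in Set.Iic (0 : ℝ), gaussianPDFReal 0 1 t) =
        ∫ t in Set.Ioi (0 : ℝ), gaussianPDFReal 0 1 t := by
      have h := integral_comp_neg_Iic (0 : ℝ) (gaussianPDFReal 0 1)
      rw [neg_zero] at h
      rw [← h]
      congr 1
      funext t
      simp [gaussianPDFReal]
    have h2 := integral_gaussianPDFReal_eq_one 0 (one_ne_zero (α := NNReal))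
    rw [← integral_add_compl (measurableSet_Iic (a := (0 : ℝ))) hint, Set.compl_Iic, ← h1] at h2
    linarith
  have hsub : (∫ t in (0 : ℝ)..x, gaussianPDFReal 0 1 t) =
      1 / Real.sqrt (2 * Real.pi) * (x * ∫ u in (0 : ℝ)..1, Real.exp (-((u * x) ^ 2 / 2))) := by
    have h := intervalIntegral.mul_integral_comp_mul_right (a := 0) (b := 1)
      (f := fun t => Real.exp (-(t ^ 2 / 2))) x
    simp only [zero_mul, one_mul] at h
    rw [h, ← intervalIntegral.integral_const_mul]
    congr 1
    funext t
    simp [gaussianPDFReal, neg_div]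
  have hcast : (∫ u in (0 : ℝ)..1, Complex.exp (-(((u : ℂ) * (x : ℂ)) ^ 2 / 2))) =
      ((∫ u in (0 : ℝ)..1, Real.exp (-((u * x) ^ 2 / 2)) : ℝ) : ℂ) := by
    rw [← intervalIntegral.integral_ofReal]
    congr 1
    funext u
    push_cast
    rfl
  rw [normalCDF, hcast, hc, hsplit, hhalf, hsub]
  push_cast
  rfl

theorem differentiable_normalCDF : Differentiable ℂ normalCDF := by
  intro z₀
  let F' : ℂ → ℝ → ℂ := fun z u =>
    Complex.exp (-(((u : ℂ) * z) ^ 2 / 2)) * -((2 * ((u : ℂ) * z) * u) / 2)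
  have hF'c : Continuous fun p : ℂ × ℝ => F' p.1 p.2 := by fun_prop
  obtain ⟨C, hC⟩ := ((isCompact_closedBall z₀ 1).prod (isCompact_Icc (a := (0 : ℝ)) (b := 1))
    ).exists_bound_of_continuousOn hF'c.continuousOn
  have key := intervalIntegral.hasDerivAt_integral_of_dominated_loc_of_deriv_le
    (μ := volume) (a := 0) (b := 1)
    (F := fun (z : ℂ) (u : ℝ) => Complex.exp (-(((u : ℂ) * z) ^ 2 / 2))) (F' := F') (x₀ := z₀)
    (bound := fun _ => C) (Metric.closedBall_mem_nhds z₀ one_pos)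
    (Eventually.of_forall fun z => Continuous.aestronglyMeasurable (by fun_prop))
    (Continuous.intervalIntegrable (by fun_prop) _ _)
    (Continuous.aestronglyMeasurable (by fun_prop))
    (Eventually.of_forall fun u hu z hz => by
      rw [Set.uIoc_of_le zero_le_one] at hu
      exact hC (z, u) ⟨hz, hu.1.le, hu.2⟩)
    intervalIntegrable_const
    (Eventually.of_forall fun u _ z _ => by
      have h1 : HasDerivAt (fun w : ℂ => (u : ℂ) * w) (u : ℂ) z := by
        simpa using (hasDerivAt_id z).const_mul (u : ℂ)
      simpa [F'] using ((h1.pow 2).div_const 2).neg.cexp)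
  exact (((differentiableAt_id).mul key.2.differentiableAt).const_mul _).const_add _

/-! ## Improper integrals -/

/-- `∫_0^∞ f(t) dt = I` as an improper integral: `f` is integrable on every `[0, T]`, and
`∫_0^T f(t) dt → I` as `T → ∞`. -/
def HasImproperIntegral (f : ℝ → ℝ) (I : ℝ) : Prop :=
  (∀ T : ℝ, 0 ≤ T → IntervalIntegrable f volume 0 T) ∧
    Tendsto (fun T : ℝ => ∫ t in (0 : ℝ)..T, f t) atTop (𝓝 I)

/-! ## The multi-hop network -/

/-- The parameters of a multi-hop network with a source (node `0`), `N` relays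
(nodes `1, …, N`) and a destination (node `N + 1`), under the `k`-hop myopic
decode-and-forward strategy. -/
structure MyopicNetwork where
  /-- number of relays -/
  N : ℕ
  /-- number of hops -/
  k : ℕ
  one_le_k : 1 ≤ k
  k_le : k ≤ N + 1
  /-- the set of dual-mode relays -/
  H : Finset {i : Fin (N + 2) // i ≠ 0 ∧ i ≠ Fin.last (N + 1)}
  /-- distances between the nodes -/
  d : Fin (N + 2) → Fin (N + 2) → ℝ
  d_pos : ∀ i j : Fin (N + 2), i < j → 0 < d i j
  /-- path loss exponent -/
  η : ℝ
  /-- power splitting parameters -/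
  a : Fin (N + 2) → Fin (N + 2) → ℝ
  a_nonneg : ∀ i j : Fin (N + 2), i < j → (j : ℕ) ≤ i + k → 0 ≤ a i j
  a_sum : ∀ i : Fin (N + 2), i ≠ Fin.last (N + 1) →
    (∑ j : Fin (N + 2) with i < j ∧ (j : ℕ) ≤ i + k, a i j) = 1
  /-- transmit power -/
  P : ℝ
  P_pos : 0 < P
  /-- noise standard deviation, so that the noise variance is `σ ^ 2` -/
  σ : ℝ
  σ_pos : 0 < σ
  /-- SNR threshold -/
  γ : ℝ
  γ_pos : 0 < γ

namespace MyopicNetwork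

variable (net : MyopicNetwork)

/-- All nodes, source and destination included. -/
abbrev Node : Type := Fin (net.N + 2)

/-- The relays, i.e. the nodes `1, …, N`. -/
abbrev Relay : Type := {i : net.Node // i ≠ 0 ∧ i ≠ Fin.last (net.N + 1)}

/-- `L_i = min (k, N + 1 - i)`: the number of subsequent nodes that node `i` can send data to,
and the size of its buffer. -/
def L (i : net.Node) : ℕ := min net.k (net.N + 1 - i)

/-- There is a link from node `i` to node `j`: `i + 1 ≤ j ≤ i + L_i`. -/
def IsLink (i j : net.Node) : Prop := i < j ∧ (j : ℕ) ≤ i + net.L i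

instance (i j : net.Node) : Decidable (net.IsLink i j) :=
  inferInstanceAs (Decidable (_ ∧ _))

/-- The type of all links of the network. -/
abbrev Link : Type := {l : net.Node × net.Node // net.IsLink l.1 l.2}

/-- A network state: the contents `β_i[n]`, `1 ≤ n ≤ L_i`, of the buffer indicator arrays of all
the relays (`true` for 1, a stored signal; `false` for 0, an empty element), and the communication
modes `λ_i` of the dual-mode relays (`true` for 1, active; `false` for 0, silent). -/
structure State where
  β : (i : net.Relay) → Finset.Icc 1 (net.L i) → Bool
  mode : net.H → Bool

/-- `𝟙_{i → j}` in the network state `s`: for a link from a relay `i` it is `β_i[j - i] λ_i` if `i`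
is dual-mode and `β_i[j - i]` otherwise; the source sends on all its links (all the elements of its
array are equal to one); where there is no link, nothing is sent. -/
def ind (s : net.State) (i j : net.Node) : ℕ :=
  if hl : net.IsLink i j then
    if h0 : i = 0 then 1
    else
      let r : net.Relay := ⟨i, h0, fun h => (hl.1.trans_le (h ▸ Fin.le_last j)).false⟩
      let n : Finset.Icc 1 (net.L r) := ⟨(j : ℕ) - i, by
        have h1 : (i : ℕ) < j := hl.1
        have h2 : (j : ℕ) ≤ i + net.L i := hl.2
        exact Finset.mem_Icc.2 ⟨by omega, by simpa [r] using (by omega : (j : ℕ) - i ≤ net.L i)⟩⟩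
      if hH : r ∈ net.H then (s.β r n).toNat * (s.mode ⟨r, hH⟩).toNat
      else (s.β r n).toNat
  else 0

/-- The instantaneous SNR at node `j` in the network state `s`, for fading coefficients `h i j`. -/
def snr (s : net.State) (h : net.Node → net.Node → ℂ) (j : net.Node) : ℝ :=
  net.P / net.σ ^ 2 *
    (∑ i : net.Node with i ≠ Fin.last (net.N + 1),
      (net.ind s i j : ℝ) * (‖h i j‖ * √((net.d i j) ^ (-net.η) * net.a i j))) ^ 2

/-- The outage probability at node `j` in the network state `s`, for random fading coefficients
`h i j`: the probability that the SNR at node `j` is below the threshold. -/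
def outageProb {Ω : Type*} [MeasurableSpace Ω] (μ : Measure Ω)
    (h : net.Node → net.Node → Ω → ℂ) (s : net.State) (j : net.Node) : ℝ :=
  μ.real {ω | net.snr s (fun i j => h i j ω) j < net.γ}

/-- The closed-form expression for the characteristic function of the scaled Rayleigh variable
that belongs to the link from `i` to `j`. -/
def φ (i j : net.Node) (t : ℝ) : ℂ :=
  1 + Complex.I * t * (√(2 * Real.pi * net.a i j / (net.d i j) ^ net.η) : ℂ) *
    Complex.exp (-((net.a i j * t ^ 2 / (2 * (net.d i j) ^ net.η) : ℝ) : ℂ)) *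
    normalCDF (Complex.I * t * (√(net.a i j / (net.d i j) ^ net.η) : ℂ))

/-- The Gil-Pelaez integrand for the outage probability at node `j` in the network state `s`. The
product is over the nodes `i` with `max (0, j - k) ≤ i ≤ j - 1`
(subtraction of natural numbers is truncated). -/
def outageIntegrand (s : net.State) (j : net.Node) (t : ℝ) : ℝ :=
  1 / t * (Complex.exp (-(Complex.I * t * (√(net.γ * net.σ ^ 2 / net.P) : ℂ))) *
    ∏ i : net.Node with i < j ∧ (j : ℕ) - net.k ≤ i, net.φ i j t ^ net.ind s i j).im

end MyopicNetwork

end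

/-! Since the received amplitude `X` at node `j` is nonnegative, the SNR is below threshold exactly
when `X < y`, where `y = √(γσ²/P) > 0`. The outage formula is therefore Gil-Pelaez inversion for
`X`. The quantity `Im(exp(-ity) φ_X(t)) / t` is the mean of `sin(t(X - y)) / t`. By Fubini (`X` has
a first moment) its integral over `[0, T]` is the mean of `Si(T(X - y))`, with `Si` the sine
integral. `Si` is bounded and tends to `±π/2` at `±∞`, so dominated convergence gives `π(1/2 - P(X <
y))`, provided `y` is not an atom (`hasImproperIntegral_gilPelaez`). It is not: `X` is either
identically `0` or has an atomless independent summand (`measure_sum_mul_eq_zero`). Independence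
makes `φ_X` a product.

For the Rayleigh factor, integration by parts gives `1 + it G(t)` with `G` the Fourier transform of
a half Gaussian. `G` solves the linear equation `G' = i - tG`, whose solution is expressed by
`Φ(it)` (`halfGaussianFourier_eq`). -/

/-! ## The Dirichlet integral -/

namespace Real

/-- The sine integral `∫_0^T sin t / t dt`. -/
noncomputable def sineIntegral (T : ℝ) : ℝ := ∫ t in (0 : ℝ)..T, sinc t

theorem hasDerivAt_sineIntegral (T : ℝ) : HasDerivAt sineIntegral (sinc T) T :=
  intervalIntegral.integral_hasDerivAt_right (continuous_sinc.intervalIntegrable _ _)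
    (continuous_sinc.stronglyMeasurableAtFilter _ _) continuous_sinc.continuousAt

theorem continuous_sineIntegral : Continuous sineIntegral :=
  continuous_iff_continuousAt.2 fun T => (hasDerivAt_sineIntegral T).continuousAt

theorem sineIntegral_neg (T : ℝ) : sineIntegral (-T) = -sineIntegral T := by
  have h := intervalIntegral.integral_comp_neg (a := 0) (b := T) sinc
  simp only [sinc_neg, neg_zero] at h
  rw [sineIntegral, sineIntegral, h, intervalIntegral.integral_symm]

theorem sineIntegral_mul (T c : ℝ) :
    sineIntegral (T * c) = ∫ t in (0 : ℝ)..T, c * sinc (t * c) := by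
  have h := intervalIntegral.mul_integral_comp_mul_right (a := 0) (b := T) (f := sinc) c
  rw [intervalIntegral.integral_const_mul, h, zero_mul, sineIntegral]

theorem integral_sin_mul_exp_neg_mul (T u : ℝ) :
    ∫ t in (0 : ℝ)..T, sin t * exp (-(t * u)) =
      (1 + u ^ 2)⁻¹ - exp (-(T * u)) * (cos T + u * sin T) / (1 + u ^ 2) := by
  have hu : (1 + u ^ 2) ≠ 0 := by positivity
  have hd : ∀ t : ℝ, HasDerivAt (fun t => -(exp (-(t * u)) * (cos t + u * sin t) / (1 + u ^ 2)))
      (sin t * exp (-(t * u))) t := by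
    intro t
    have h1 : HasDerivAt (fun t : ℝ => exp (-(t * u))) (exp (-(t * u)) * -u) t := by
      simpa using ((hasDerivAt_id t).mul_const u).neg.exp
    have h2 : HasDerivAt (fun t : ℝ => cos t + u * sin t) (-sin t + u * cos t) t :=
      (hasDerivAt_cos t).add ((hasDerivAt_sin t).const_mul u)
    refine ((h1.mul h2).div_const (1 + u ^ 2)).neg.congr_deriv ?_
    field_simp
    ring
  rw [intervalIntegral.integral_eq_sub_of_hasDerivAt (fun t _ => hd t)
    (Continuous.intervalIntegrable (by fun_prop) _ _)]
  simp
  ring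

theorem integral_exp_neg_mul_Ioi {t : ℝ} (ht : 0 < t) :
    ∫ u in Set.Ioi (0 : ℝ), exp (-(t * u)) = t⁻¹ := by
  have h := integral_exp_mul_Ioi (neg_lt_zero.2 ht) 0
  simpa [neg_div] using h

theorem integrableOn_exp_neg_mul_Ioi {t : ℝ} (ht : 0 < t) :
    IntegrableOn (fun u => exp (-(t * u))) (Set.Ioi 0) := by
  simpa using integrableOn_exp_mul_Ioi (neg_lt_zero.2 ht) 0

/-- Integrating the absolute value in `u` first leaves `|sin t| / t = |sinc t|`, which is integrable
on `(0, T]` for finite `T`. -/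
theorem integrable_prod_sin_mul_exp_neg_mul (T : ℝ) :
    Integrable (fun p : ℝ × ℝ => sin p.1 * exp (-(p.1 * p.2)))
      ((volume.restrict (Set.Ioc 0 T)).prod (volume.restrict (Set.Ioi 0))) := by
  rw [integrable_prod_iff (Continuous.aestronglyMeasurable (by fun_prop))]
  constructor
  · filter_upwards [ae_restrict_mem measurableSet_Ioc] with t ht
    exact (integrableOn_exp_neg_mul_Ioi ht.1).const_mul _
  · have h : IntegrableOn (fun t => |sinc t|) (Set.Ioc 0 T) :=
      ((continuous_sinc.abs.continuousOn (s := Set.Icc 0 T)).integrableOn_Icc).mono_set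
        Set.Ioc_subset_Icc_self
    refine h.congr ?_
    filter_upwards [ae_restrict_mem measurableSet_Ioc] with t ht
    simp only [norm_mul, norm_eq_abs, abs_exp]
    rw [integral_const_mul, integral_exp_neg_mul_Ioi ht.1, sinc_of_ne_zero ht.1.ne', abs_div,
      abs_of_pos ht.1, div_eq_mul_inv]

theorem abs_exp_mul_cos_add_mul_sin_div_le (T : ℝ) {u : ℝ} (hu : 0 ≤ u) :
    |exp (-(T * u)) * (cos T + u * sin T) / (1 + u ^ 2)| ≤ 2 * exp (-(T * u)) := by
  have h1 : |cos T + u * sin T| ≤ 1 + u := by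
    refine (abs_add_le _ _).trans (add_le_add (abs_cos_le_one T) ?_)
    rw [abs_mul, abs_of_nonneg hu]
    exact mul_le_of_le_one_right hu (abs_sin_le_one T)
  have h2 : 1 + u ≤ 2 * (1 + u ^ 2) := by nlinarith [sq_nonneg (u - 1)]
  rw [abs_div, abs_mul, abs_exp, abs_of_pos (by positivity : 0 < 1 + u ^ 2),
    div_le_iff₀ (by positivity)]
  calc exp (-(T * u)) * |cos T + u * sin T| ≤ exp (-(T * u)) * (2 * (1 + u ^ 2)) := by
        gcongr; exact h1.trans h2
    _ = 2 * exp (-(T * u)) * (1 + u ^ 2) := by ring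

/-- Write `1/t` as `∫ exp(-tu) du` over `u > 0` and swap the integrals. The main term `∫ du / (1 +
u²)` is `π/2`, and the remainder is dominated by `2 exp(-Tu)`. -/
theorem abs_sineIntegral_sub_le {T : ℝ} (hT : 0 < T) : |sineIntegral T - π / 2| ≤ 2 / T := by
  have hint : IntegrableOn (fun u => exp (-(T * u)) * (cos T + u * sin T) / (1 + u ^ 2))
      (Set.Ioi 0) := by
    refine Integrable.mono' ((integrableOn_exp_neg_mul_Ioi hT).const_mul 2)
      (Measurable.aestronglyMeasurable (by fun_prop)) ?_
    filter_upwards [ae_restrict_mem measurableSet_Ioi] with u hu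
    exact abs_exp_mul_cos_add_mul_sin_div_le T (le_of_lt hu)
  have key : sineIntegral T =
      π / 2 - ∫ u in Set.Ioi (0 : ℝ), exp (-(T * u)) * (cos T + u * sin T) / (1 + u ^ 2) := by
    calc sineIntegral T
        = ∫ t in Set.Ioc 0 T, ∫ u in Set.Ioi (0 : ℝ), sin t * exp (-(t * u)) := by
          rw [sineIntegral, intervalIntegral.integral_of_le hT.le]
          refine setIntegral_congr_fun measurableSet_Ioc fun t ht => ?_
          rw [integral_const_mul, integral_exp_neg_mul_Ioi ht.1, sinc_of_ne_zero ht.1.ne',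
            div_eq_mul_inv]
      _ = ∫ u in Set.Ioi (0 : ℝ), ∫ t in Set.Ioc 0 T, sin t * exp (-(t * u)) :=
          integral_integral_swap (integrable_prod_sin_mul_exp_neg_mul T)
      _ = ∫ u in Set.Ioi (0 : ℝ),
            ((1 + u ^ 2)⁻¹ - exp (-(T * u)) * (cos T + u * sin T) / (1 + u ^ 2)) := by
          congr 1
          funext u
          rw [← intervalIntegral.integral_of_le hT.le, integral_sin_mul_exp_neg_mul]
      _ = _ := by
          rw [integral_sub integrable_inv_one_add_sq.integrableOn hint,
            integral_Ioi_inv_one_add_sq, arctan_zero, sub_zero]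
  rw [key, sub_sub_cancel_left, abs_neg, ← norm_eq_abs]
  calc _ ≤ ∫ u in Set.Ioi (0 : ℝ), 2 * exp (-(T * u)) := by
        refine norm_integral_le_of_norm_le ((integrableOn_exp_neg_mul_Ioi hT).const_mul 2) ?_
        filter_upwards [ae_restrict_mem measurableSet_Ioi] with u hu
        exact abs_exp_mul_cos_add_mul_sin_div_le T (le_of_lt hu)
    _ = 2 / T := by rw [integral_const_mul, integral_exp_neg_mul_Ioi hT, div_eq_mul_inv]

/-- The Dirichlet integral. -/
theorem tendsto_sineIntegral_atTop : Tendsto sineIntegral atTop (𝓝 (π / 2)) := by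
  rw [tendsto_iff_norm_sub_tendsto_zero]
  refine squeeze_zero' (Eventually.of_forall fun _ => norm_nonneg _) ?_
    (tendsto_const_nhds.div_atTop tendsto_id : Tendsto (fun T : ℝ => 2 / T) atTop (𝓝 0))
  filter_upwards [eventually_gt_atTop 0] with T hT using abs_sineIntegral_sub_le hT

/-- A crude uniform bound, serving as the dominating constant in Gil-Pelaez inversion: `|sinc| ≤ 1`
covers `[0, 1]`, the error `2 / T` covers `T ≥ 1`, and oddness the rest. -/
theorem abs_sineIntegral_le (T : ℝ) : |sineIntegral T| ≤ π / 2 + 2 := by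
  have hpos : ∀ S : ℝ, 0 ≤ S → |sineIntegral S| ≤ π / 2 + 2 := by
    intro S hS
    rcases le_total S 1 with h | h
    · have h1 : ‖∫ t in (0 : ℝ)..S, sinc t‖ ≤ 1 * |S - 0| :=
        intervalIntegral.norm_integral_le_of_norm_le_const fun t _ => abs_sinc_le_one t
      rw [sub_zero, abs_of_nonneg hS, one_mul, norm_eq_abs] at h1
      have := pi_pos
      exact h1.trans (by linarith)
    · have h1 := abs_sineIntegral_sub_le (zero_lt_one.trans_le h)
      have h2 : 2 / S ≤ 2 := div_le_self zero_le_two h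
      have := abs_le.1 (h1.trans h2)
      have := pi_pos
      exact abs_le.2 ⟨by linarith, by linarith⟩
  rcases le_total 0 T with h | h
  · exact hpos T h
  · simpa [sineIntegral_neg] using hpos (-T) (neg_nonneg.2 h)

end Real

/-! ## The Gil-Pelaez inversion formula -/

section GilPelaez

variable (ν : Measure ℝ) [IsProbabilityMeasure ν]

theorem im_cexp_neg_mul_charFun (y t : ℝ) :
    (Complex.exp (-(Complex.I * t * y)) * charFun ν t).im = ∫ x, Real.sin (t * (x - y)) ∂ν := by
  rw [charFun_apply_real, ← integral_const_mul]
  have hint : Integrable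
      (fun x : ℝ => Complex.exp (-(Complex.I * t * y)) * Complex.exp (t * x * Complex.I)) ν := by
    refine Integrable.of_bound (C := 1) (Continuous.aestronglyMeasurable (by fun_prop))
      (Eventually.of_forall fun x => ?_)
    simp [Complex.norm_exp]
  have h := integral_im hint
  simp only [RCLike.im_to_complex] at h
  rw [← h]
  congr 1
  funext x
  rw [← Complex.exp_add, show -(Complex.I * t * y) + t * x * Complex.I =
    ((t * (x - y) : ℝ) : ℂ) * Complex.I by push_cast; ring, Complex.exp_ofReal_mul_I_im]

/-- Writing `sin(t(x - y)) / t` through `sinc` makes it jointly continuous and bounded by `|x - y|`,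
as Fubini requires. -/
theorem one_div_mul_im_cexp_neg_mul_charFun (y : ℝ) {t : ℝ} (ht : t ≠ 0) :
    1 / t * (Complex.exp (-(Complex.I * t * y)) * charFun ν t).im =
      ∫ x, (x - y) * Real.sinc (t * (x - y)) ∂ν := by
  rw [im_cexp_neg_mul_charFun, ← integral_const_mul]
  congr 1
  funext x
  rcases eq_or_ne x y with rfl | h
  · simp
  · have h' := sub_ne_zero.2 h
    rw [Real.sinc_of_ne_zero (mul_ne_zero ht h')]
    field_simp

variable {ν}

theorem integrable_prod_sub_mul_sinc (hν : Integrable id ν) (y T : ℝ) :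
    Integrable (fun p : ℝ × ℝ => (p.2 - y) * Real.sinc (p.1 * (p.2 - y)))
      ((volume.restrict (Set.Ioc 0 T)).prod ν) := by
  have hb : Integrable (fun p : ℝ × ℝ => p.2 - y) ((volume.restrict (Set.Ioc 0 T)).prod ν) :=
    (hν.sub (integrable_const y)).comp_snd _
  have hc : Continuous fun p : ℝ × ℝ => (p.2 - y) * Real.sinc (p.1 * (p.2 - y)) := by
    have := Real.continuous_sinc
    fun_prop
  refine hb.mono hc.aestronglyMeasurable (Eventually.of_forall fun p => ?_)
  rw [norm_mul]
  exact mul_le_of_le_one_right (norm_nonneg _) (Real.abs_sinc_le_one _)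

/-- The Gil-Pelaez inversion formula at a point that is not an atom. -/
theorem hasImproperIntegral_gilPelaez (hν : Integrable id ν) {y : ℝ} (hy : ν {y} = 0) :
    HasImproperIntegral
      (fun t => 1 / t * (Complex.exp (-(Complex.I * t * y)) * charFun ν t).im)
      (Real.pi * (1 / 2 - ν.real (Set.Iio y))) := by
  have hae : ∀ T : ℝ, (fun t => 1 / t * (Complex.exp (-(Complex.I * t * y)) * charFun ν t).im)
      =ᵐ[volume.restrict (Set.Ioc 0 T)]
        fun t => ∫ x, (x - y) * Real.sinc (t * (x - y)) ∂ν := by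
    intro T
    filter_upwards [ae_restrict_mem measurableSet_Ioc] with t ht
    exact one_div_mul_im_cexp_neg_mul_charFun ν y ht.1.ne'
  refine ⟨fun T hT => ?_, ?_⟩
  · rw [intervalIntegrable_iff_integrableOn_Ioc_of_le hT]
    exact (integrable_prod_sub_mul_sinc hν y T).integral_prod_left.congr (hae T).symm
  · have hev : (fun T => ∫ x, Real.sineIntegral (T * (x - y)) ∂ν) =ᶠ[atTop] fun T => ∫ t in (0 : ℝ)..T,
        1 / t * (Complex.exp (-(Complex.I * t * y)) * charFun ν t).im := by
      filter_upwards [eventually_ge_atTop 0] with T hT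
      rw [intervalIntegral.integral_of_le hT, integral_congr_ae (hae T),
        integral_integral_swap (integrable_prod_sub_mul_sinc hν y T)]
      congr 1
      funext x
      rw [Real.sineIntegral_mul, intervalIntegral.integral_of_le hT]
    refine Tendsto.congr' hev ?_
    -- The pointwise limit is `-π/2` left of `y` and `π/2` right of it. At `x = y` the true limit is
    -- `0`, but that point is null.
    have hlim : ∫ x, (Set.indicator (Set.Iio y) (fun _ => -Real.pi) x + Real.pi / 2) ∂ν =
        Real.pi * (1 / 2 - ν.real (Set.Iio y)) := by
      rw [integral_add ((integrable_const _).indicator measurableSet_Iio) (integrable_const _),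
        integral_indicator_const _ measurableSet_Iio]
      simp
      ring
    rw [← hlim]
    refine tendsto_integral_filter_of_dominated_convergence (fun _ => Real.pi / 2 + 2)
      (Eventually.of_forall fun T => ?_)
      (Eventually.of_forall fun T => Eventually.of_forall fun x => Real.abs_sineIntegral_le _)
      (integrable_const _) ?_
    · have := Real.continuous_sineIntegral
      exact Continuous.aestronglyMeasurable (by fun_prop)
    · have hne : ∀ᵐ x ∂ν, x ≠ y := by
        rw [ae_iff]
        simpa using hy
      filter_upwards [hne] with x hx
      rcases lt_or_gt_of_ne hx with h | h
      · rw [Set.indicator_of_mem (Set.mem_Iio.2 h),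
          show -Real.pi + Real.pi / 2 = -(Real.pi / 2) by ring]
        have h1 := (Real.tendsto_sineIntegral_atTop.comp
          (tendsto_id.atTop_mul_const (sub_pos.2 h))).neg
        refine h1.congr fun T => ?_
        simp only [Function.comp, id]
        rw [← Real.sineIntegral_neg]
        congr 1
        ring
      · rw [Set.indicator_of_notMem (by simpa using h.le), zero_add]
        exact Real.tendsto_sineIntegral_atTop.comp
          (tendsto_id.atTop_mul_const (sub_pos.2 h))

end GilPelaez

/-! ## The characteristic function of the Rayleigh distribution -/

section Rayleigh

theorem measurable_rayleigh_density (b : ℝ) : Measurable fun x : ℝ =>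
    ENNReal.ofReal (if 0 ≤ x then x / b ^ 2 * Real.exp (-(x ^ 2 / (2 * b ^ 2))) else 0) :=
  (Measurable.ite measurableSet_Ici (by fun_prop) measurable_const).ennreal_ofReal

theorem rayleighMeasure_absolutelyContinuous (b : ℝ) : rayleighMeasure b ≪ volume :=
  withDensity_absolutelyContinuous _ _

theorem rayleighMeasure_singleton (b x : ℝ) : rayleighMeasure b {x} = 0 :=
  rayleighMeasure_absolutelyContinuous b (measure_singleton x)

theorem integral_rayleighMeasure_one {E : Type*} [NormedAddCommGroup E] [NormedSpace ℝ E]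
    (g : ℝ → E) :
    ∫ x, g x ∂(rayleighMeasure 1) =
      ∫ x in Set.Ioi (0 : ℝ), (x * Real.exp (-(x ^ 2 / 2))) • g x := by
  rw [rayleighMeasure, integral_withDensity_eq_integral_toReal_smul
    (measurable_rayleigh_density 1) (Eventually.of_forall fun _ => ENNReal.ofReal_lt_top),
    ← integral_indicator measurableSet_Ioi]
  congr 1
  funext x
  rcases lt_trichotomy x 0 with h | rfl | h
  · simp [not_le.2 h, h.le]
  · simp
  · rw [ENNReal.toReal_ofReal (by rw [if_pos h.le]; positivity), if_pos h.le,
      Set.indicator_of_mem (Set.mem_Ioi.2 h)]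
    simp

/-- The density contributes a factor `x`, so the Gaussian second moment dominates. -/
theorem integrable_id_rayleighMeasure_one : Integrable id (rayleighMeasure 1) := by
  rw [rayleighMeasure, integrable_withDensity_iff_integrable_smul'
    (measurable_rayleigh_density 1) (Eventually.of_forall fun _ => ENNReal.ofReal_lt_top)]
  have h : Integrable fun x : ℝ => x ^ 2 * Real.exp (-(1 / 2) * x ^ 2) := by
    simpa using integrable_rpow_mul_exp_neg_mul_sq (b := 1 / 2) (by norm_num) (s := 2) (by norm_num)
  refine h.mono' (((measurable_rayleigh_density 1).ennreal_toReal.smul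
    measurable_id).aestronglyMeasurable) (Eventually.of_forall fun x => ?_)
  rcases lt_or_ge x 0 with hx | hx
  · simp only [not_le.2 hx, if_false, ENNReal.ofReal_zero, ENNReal.toReal_zero, zero_smul,
      norm_zero]
    positivity
  · rw [ENNReal.toReal_ofReal (by rw [if_pos hx]; positivity), if_pos hx, id, smul_eq_mul,
      Real.norm_of_nonneg (by positivity)]
    apply le_of_eq
    rw [show -(x ^ 2 / (2 * (1 : ℝ) ^ 2)) = -(1 / 2) * x ^ 2 by ring]
    ring

/-- `∫_0^∞ exp (-r²/2 + i t r) dr`. -/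
noncomputable def halfGaussianFourier (t : ℝ) : ℂ :=
  ∫ r in Set.Ioi (0 : ℝ), Complex.exp (-((r : ℂ) ^ 2 / 2) + Complex.I * t * r)

theorem norm_cexp_neg_sq_add (t r : ℝ) :
    ‖Complex.exp (-((r : ℂ) ^ 2 / 2) + Complex.I * t * r)‖ = Real.exp (-(1 / 2) * r ^ 2) := by
  rw [Complex.norm_exp]
  congr 1
  simp [← Complex.ofReal_pow]
  ring

theorem integrable_cexp_neg_sq_add (t : ℝ) :
    Integrable fun r : ℝ => Complex.exp (-((r : ℂ) ^ 2 / 2) + Complex.I * t * r) := by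
  refine (integrable_exp_neg_mul_sq (b := 1 / 2) (by norm_num)).mono'
    (Continuous.aestronglyMeasurable (by fun_prop)) (Eventually.of_forall fun r => ?_)
  rw [norm_cexp_neg_sq_add]

theorem integrable_mul_cexp_neg_sq_add (t : ℝ) :
    Integrable fun r : ℝ => (r : ℂ) * Complex.exp (-((r : ℂ) ^ 2 / 2) + Complex.I * t * r) := by
  refine (integrable_mul_exp_neg_mul_sq (b := 1 / 2) (by norm_num)).norm.mono'
    (Continuous.aestronglyMeasurable (by fun_prop)) (Eventually.of_forall fun r => ?_)
  rw [norm_mul, norm_mul, norm_cexp_neg_sq_add, Complex.norm_real,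
    Real.norm_of_nonneg (Real.exp_pos _).le]

/-- Integration by parts: the exponential has derivative `(it - r)` times itself, equals `1` at `r =
0` and vanishes at infinity. -/
theorem integral_mul_cexp_neg_sq_add (t : ℝ) :
    ∫ r in Set.Ioi (0 : ℝ), (r : ℂ) * Complex.exp (-((r : ℂ) ^ 2 / 2) + Complex.I * t * r) =
      1 + Complex.I * t * halfGaussianFourier t := by
  have hd : ∀ r : ℝ, HasDerivAt
      (fun r : ℝ => Complex.exp (-((r : ℂ) ^ 2 / 2) + Complex.I * t * r))
      (Complex.I * t * Complex.exp (-((r : ℂ) ^ 2 / 2) + Complex.I * t * r) -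
        (r : ℂ) * Complex.exp (-((r : ℂ) ^ 2 / 2) + Complex.I * t * r)) r := by
    intro r
    have h0 : HasDerivAt (fun r : ℝ => (r : ℂ)) 1 r := Complex.ofRealCLM.hasDerivAt
    have h1 := (((h0.pow 2).div_const 2).neg.add (h0.const_mul (Complex.I * t))).cexp
    refine h1.congr_deriv ?_
    push_cast
    simp only [Pi.add_apply, Pi.neg_apply, Pi.pow_apply]
    ring
  have hlim : Tendsto (fun r : ℝ => Complex.exp (-((r : ℂ) ^ 2 / 2) + Complex.I * t * r)) atTop
      (𝓝 0) := by
    rw [tendsto_zero_iff_norm_tendsto_zero]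
    simp only [norm_cexp_neg_sq_add]
    exact Real.tendsto_exp_atBot.comp
      ((tendsto_pow_atTop two_ne_zero).const_mul_atTop_of_neg (by norm_num))
  have hi := (integrable_cexp_neg_sq_add t).const_mul (Complex.I * t)
  have hj := integrable_mul_cexp_neg_sq_add t
  have h := integral_Ioi_of_hasDerivAt_of_tendsto' (a := 0) (fun r _ => hd r)
    (hi.sub hj).integrableOn hlim
  rw [integral_sub hi.integrableOn hj.integrableOn, integral_const_mul] at h
  simp only [Complex.ofReal_zero] at h
  rw [halfGaussianFourier]
  linear_combination (exp := 1) -h + (by simp :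
    Complex.exp (-((0 : ℂ) ^ 2 / 2) + Complex.I * t * 0) = 1)

/-- Differentiating under the integral brings down `ir`; the integration by parts above then closes
this into a linear differential equation. -/
theorem hasDerivAt_halfGaussianFourier (t : ℝ) :
    HasDerivAt halfGaussianFourier (Complex.I * (1 + Complex.I * t * halfGaussianFourier t)) t := by
  have key := hasDerivAt_integral_of_dominated_loc_of_deriv_le
    (μ := volume.restrict (Set.Ioi 0))
    (F := fun (t r : ℝ) => Complex.exp (-((r : ℂ) ^ 2 / 2) + Complex.I * t * r))
    (F' := fun (t r : ℝ) =>
      Complex.I * ((r : ℂ) * Complex.exp (-((r : ℂ) ^ 2 / 2) + Complex.I * t * r)))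
    (x₀ := t) (bound := fun r => ‖r * Real.exp (-(1 / 2) * r ^ 2)‖) univ_mem
    (Eventually.of_forall fun t => (integrable_cexp_neg_sq_add t).integrableOn.aestronglyMeasurable)
    (integrable_cexp_neg_sq_add t).integrableOn
    ((integrable_mul_cexp_neg_sq_add t).const_mul _).integrableOn.aestronglyMeasurable
    (Eventually.of_forall fun r t _ => by
      rw [norm_mul, norm_mul, norm_mul, norm_cexp_neg_sq_add, Complex.norm_I, one_mul,
        Complex.norm_real, Real.norm_of_nonneg (Real.exp_pos _).le])
    (integrable_mul_exp_neg_mul_sq (b := 1 / 2) (by norm_num)).norm.integrableOn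
    (Eventually.of_forall fun r t _ => by
      have h0 : HasDerivAt (fun t : ℝ => (t : ℂ)) 1 t := Complex.ofRealCLM.hasDerivAt
      have h1 := (((h0.const_mul Complex.I).mul_const (r : ℂ)).const_add (-((r : ℂ) ^ 2 / 2))).cexp
      refine h1.congr_deriv ?_
      ring)
  rw [integral_const_mul, integral_mul_cexp_neg_sq_add] at key
  exact key.2

theorem halfGaussianFourier_zero : halfGaussianFourier 0 = (√(2 * Real.pi) : ℂ) / 2 := by
  have h := integral_gaussian_Ioi (1 / 2)
  rw [show Real.pi / (1 / 2) = 2 * Real.pi by ring] at h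
  have hcast : (√(2 * Real.pi) : ℂ) / 2 =
      ((∫ r in Set.Ioi (0 : ℝ), Real.exp (-(1 / 2) * r ^ 2) : ℝ) : ℂ) := by
    rw [h]
    push_cast
    rfl
  rw [hcast, ← integral_complex_ofReal, halfGaussianFourier]
  congr 1
  funext r
  push_cast
  congr 1
  ring

/-- Along the imaginary axis `-(is)²/2 = s²/2`, so a real substitution `s = ut` suffices. -/
theorem normalCDF_I_mul (t : ℝ) : normalCDF (Complex.I * t) =
    1 / 2 + 1 / (√(2 * Real.pi) : ℂ) *
      (Complex.I * ∫ s in (0 : ℝ)..t, Complex.exp ((s : ℂ) ^ 2 / 2)) := by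
  have h := intervalIntegral.smul_integral_comp_mul_right (a := 0) (b := 1)
    (f := fun s : ℝ => Complex.exp ((s : ℂ) ^ 2 / 2)) t
  rw [zero_mul, one_mul] at h
  rw [normalCDF, ← h, Complex.real_smul, mul_assoc]
  congr 5
  funext u
  push_cast
  congr 1
  linear_combination -((u : ℂ) * t) ^ 2 / 2 * Complex.I_sq

theorem hasDerivAt_normalCDF_I_mul (t : ℝ) :
    HasDerivAt (fun t : ℝ => normalCDF (Complex.I * t))
      (1 / (√(2 * Real.pi) : ℂ) * (Complex.I * Complex.exp ((t : ℂ) ^ 2 / 2))) t := by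
  simp only [normalCDF_I_mul]
  have hc : Continuous fun s : ℝ => Complex.exp ((s : ℂ) ^ 2 / 2) := by fun_prop
  have h := intervalIntegral.integral_hasDerivAt_right (hc.intervalIntegrable 0 t)
    (hc.stronglyMeasurableAtFilter _ _) hc.continuousAt
  exact ((h.const_mul Complex.I).const_mul _).const_add _

theorem halfGaussianFourier_eq (t : ℝ) : halfGaussianFourier t =
    √(2 * Real.pi) * Complex.exp (-((t : ℂ) ^ 2 / 2)) * normalCDF (Complex.I * t) := by
  have hs : (√(2 * Real.pi) : ℂ) ≠ 0 := by
    exact_mod_cast (Real.sqrt_pos.2 (by positivity)).ne'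
  -- With the integrating factor `exp(t²/2)`, both terms have derivative `i exp(t²/2)`; at `0` both
  -- equal `√(2π)/2`.
  have hd : ∀ t : ℝ, HasDerivAt (fun t : ℝ => Complex.exp ((t : ℂ) ^ 2 / 2) * halfGaussianFourier t -
      √(2 * Real.pi) * normalCDF (Complex.I * t)) 0 t := by
    intro t
    have h0 : HasDerivAt (fun r : ℝ => (r : ℂ)) 1 t := Complex.ofRealCLM.hasDerivAt
    have h1 := ((h0.pow 2).div_const 2).cexp
    refine ((h1.mul (hasDerivAt_halfGaussianFourier t)).sub
      ((hasDerivAt_normalCDF_I_mul t).const_mul _)).congr_deriv ?_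
    simp only [Pi.pow_apply]
    field_simp
    push_cast
    linear_combination 2 * Complex.exp ((t : ℂ) ^ 2 / 2) * t * halfGaussianFourier t * Complex.I_sq
  have hconst := is_const_of_deriv_eq_zero (fun t => (hd t).differentiableAt)
    (fun t => (hd t).deriv) t 0
  have h0 : normalCDF (Complex.I * (0 : ℝ)) = 1 / 2 := by simp [normalCDF]
  rw [h0, halfGaussianFourier_zero] at hconst
  have hexp : Complex.exp (-((t : ℂ) ^ 2 / 2)) * Complex.exp ((t : ℂ) ^ 2 / 2) = 1 := by
    rw [← Complex.exp_add, neg_add_cancel, Complex.exp_zero]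
  have hz : Complex.exp (((0 : ℝ) : ℂ) ^ 2 / 2) = 1 := by simp
  rw [hz] at hconst
  linear_combination Complex.exp (-((t : ℂ) ^ 2 / 2)) * hconst - halfGaussianFourier t * hexp

theorem charFun_rayleighMeasure_one (t : ℝ) : charFun (rayleighMeasure 1) t =
    1 + Complex.I * t * √(2 * Real.pi) * Complex.exp (-((t : ℂ) ^ 2 / 2)) *
      normalCDF (Complex.I * t) := by
  rw [charFun_apply_real, integral_rayleighMeasure_one]
  have h := integral_mul_cexp_neg_sq_add t
  rw [halfGaussianFourier_eq] at h
  rw [show 1 + Complex.I * t * √(2 * Real.pi) * Complex.exp (-((t : ℂ) ^ 2 / 2)) *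
      normalCDF (Complex.I * t) = 1 + Complex.I * t * (√(2 * Real.pi) *
      Complex.exp (-((t : ℂ) ^ 2 / 2)) * normalCDF (Complex.I * t)) by ring, ← h]
  congr 1
  funext r
  rw [Complex.real_smul, Complex.exp_add]
  push_cast
  ring_nf

end Rayleigh

/-! ## Linear combinations of independent random variables -/

section LinearCombination

variable {Ω : Type*} [MeasurableSpace Ω] {μ : Measure Ω}

theorem iIndepFun_const_mul {ι : Type*} {R : ι → Ω → ℝ} (hR : iIndepFun R μ) (c : ι → ℝ) :
    iIndepFun (fun i ω => c i * R i ω) μ :=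
  hR.comp (fun i x => c i * x) fun i => measurable_const_mul (c i)

variable [IsProbabilityMeasure μ]

/-- The sum of two independent random variables one of which has an atomless law is atomless. -/
theorem measure_add_eq_zero_of_indepFun {A B : Ω → ℝ} (hA : AEMeasurable A μ)
    (hB : AEMeasurable B μ) (hAB : IndepFun A B μ) (hna : ∀ y, μ {ω | B ω = y} = 0) (y : ℝ) :
    μ {ω | A ω + B ω = y} = 0 := by
  have hs : MeasurableSet {p : ℝ × ℝ | p.1 + p.2 = y} :=
    measurableSet_eq_fun (by fun_prop) measurable_const
  have h1 : μ.map (fun ω => (A ω, B ω)) {p : ℝ × ℝ | p.1 + p.2 = y} = 0 := by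
    -- Under the product law, the slice of the line over `A = a` is the single point `B = y - a`,
    -- which is null.
    rw [(indepFun_iff_map_prod_eq_prod_map_map hA hB).1 hAB, Measure.measure_prod_null hs]
    refine Eventually.of_forall fun a => ?_
    simp only [Pi.zero_apply]
    rw [Measure.map_apply_of_aemeasurable hB (measurable_prodMk_left hs)]
    refine measure_mono_null (fun ω hω => ?_) (hna (y - a))
    exact eq_sub_of_add_eq' hω
  rwa [Measure.map_apply_of_aemeasurable (hA.prodMk hB) hs] at h1

variable {ι : Type*} [Fintype ι] {R : ι → Ω → ℝ}

/-- A linear combination of independent atomless random variables has no atom outside `0`. -/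
theorem measure_sum_mul_eq_zero (hm : ∀ i, AEMeasurable (R i) μ) (hR : iIndepFun R μ)
    (hna : ∀ i y, μ {ω | R i ω = y} = 0) (c : ι → ℝ) {y : ℝ} (hy : y ≠ 0) :
    μ {ω | ∑ i, c i * R i ω = y} = 0 := by
  classical
  -- If all coefficients vanish, the sum is the constant `0` and only `y ≠ 0` helps. Otherwise split
  -- off one term with nonzero coefficient, which is atomless and independent of the rest.
  by_cases hc : ∀ i, c i = 0
  · simp [hc, hy.symm]
  · push Not at hc
    obtain ⟨i, hi⟩ := hc
    have hm' : ∀ i, AEMeasurable (fun ω => c i * R i ω) μ := fun i => (hm i).const_mul _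
    have hind := iIndepFun.indepFun_finsetSum_of_notMem₀ (iIndepFun_const_mul hR c) hm'
      (Finset.notMem_erase i Finset.univ)
    have h := measure_add_eq_zero_of_indepFun
      (Finset.aemeasurable_sum _ fun j _ => hm' j) (hm' i) hind (fun z => ?_) y
    · simpa only [Finset.sum_apply, Finset.sum_erase_add _ _ (Finset.mem_univ i)] using h
    · refine measure_mono_null (fun ω hω => ?_) (hna i (z / c i))
      exact eq_div_of_mul_eq hi (by rw [mul_comm]; exact hω)

/-- Gil-Pelaez inversion for a linear combination of independent atomless random variables. -/
theorem hasImproperIntegral_gilPelaez_sum_mul (hm : ∀ i, Integrable (R i) μ)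
    (hR : iIndepFun R μ) (hna : ∀ i y, μ {ω | R i ω = y} = 0) (c : ι → ℝ) {y : ℝ} (hy : y ≠ 0) :
    HasImproperIntegral
      (fun t => 1 / t * (Complex.exp (-(Complex.I * t * y)) *
        ∏ i, charFun (μ.map fun ω => c i * R i ω) t).im)
      (Real.pi * (1 / 2 - μ.real {ω | ∑ i, c i * R i ω < y})) := by
  have hX : AEMeasurable (fun ω => ∑ i, c i * R i ω) μ :=
    Finset.aemeasurable_fun_sum _ fun i _ => (hm i).aemeasurable.const_mul _
  have : IsProbabilityMeasure (μ.map fun ω => ∑ i, c i * R i ω) := Measure.isProbabilityMeasure_map hX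
  have hint : Integrable id (μ.map fun ω => ∑ i, c i * R i ω) :=
    (integrable_map_measure aestronglyMeasurable_id hX).2
      (integrable_finsetSum _ fun i _ => (hm i).const_mul _)
  have hatom : (μ.map fun ω => ∑ i, c i * R i ω) {y} = 0 := by
    rw [Measure.map_apply_of_aemeasurable hX (measurableSet_singleton y)]
    exact measure_sum_mul_eq_zero (fun i => (hm i).aemeasurable) hR hna c hy
  have h := hasImproperIntegral_gilPelaez hint hatom
  rw [(iIndepFun_const_mul hR c).charFun_map_fun_sum_eq_prod fun i => (hm i).aemeasurable.const_mul _,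
    map_measureReal_apply_of_aemeasurable hX measurableSet_Iio] at h
  simp only [Finset.prod_apply] at h
  exact h

end LinearCombination

/-! ## The outage probability -/

namespace MyopicNetwork

variable (net : MyopicNetwork)

theorem charFun_map_norm_mul {Ω : Type*} [MeasurableSpace Ω] {μ : Measure Ω}
    {h : net.Node → net.Node → Ω → ℂ} {i j : net.Node} (hl : net.IsLink i j)
    (hlaw : HasLaw (fun ω => ‖h i j ω‖) (rayleighMeasure 1) μ) (t : ℝ) :
    charFun (μ.map fun ω => ‖h i j ω‖ * √((net.d i j) ^ (-net.η) * net.a i j)) t =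
      net.φ i j t := by
  have hd := net.d_pos i j hl.1
  have ha : 0 ≤ net.a i j / net.d i j ^ net.η :=
    div_nonneg (net.a_nonneg i j hl.1 (hl.2.trans (by simp [L]))) (by positivity)
  have hc : (net.d i j) ^ (-net.η) * net.a i j = net.a i j / net.d i j ^ net.η := by
    rw [Real.rpow_neg hd.le, div_eq_inv_mul]
  have hmul : ∀ c : ℝ, (μ.map fun ω => ‖h i j ω‖ * c) = (rayleighMeasure 1).map (c * ·) := by
    intro c
    rw [← hlaw.map_eq, AEMeasurable.map_map_of_aemeasurable (by fun_prop) hlaw.aemeasurable]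
    congr 1
    funext ω
    exact mul_comm _ _
  have hsqrt : √(2 * Real.pi * net.a i j / net.d i j ^ net.η) =
      √(2 * Real.pi) * √(net.a i j / net.d i j ^ net.η) := by
    rw [mul_div_assoc, Real.sqrt_mul (by positivity)]
  have he : -(((√(net.a i j / net.d i j ^ net.η) * t : ℝ) : ℂ) ^ 2 / 2) =
      -((net.a i j * t ^ 2 / (2 * (net.d i j) ^ net.η) : ℝ) : ℂ) := by
    rw [← Complex.ofReal_pow, mul_pow, Real.sq_sqrt ha]
    push_cast
    ring
  rw [hmul, charFun_map_mul, charFun_rayleighMeasure_one, hc, φ, he, hsqrt,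
    show Complex.I * ((√(net.a i j / net.d i j ^ net.η) * t : ℝ) : ℂ) =
      Complex.I * t * √(net.a i j / net.d i j ^ net.η) by push_cast; ring]
  push_cast
  ring

variable {net}

/-- The cap `N + 1 - i` in `L` is automatic because `j ≤ N + 1`, so the product in the integrand
runs exactly over the links into `j`. -/
theorem isLink_iff {i j : net.Node} :
    net.IsLink i j ↔ i < j ∧ (j : ℕ) - net.k ≤ i := by
  have := j.isLt
  simp only [IsLink, L, Fin.lt_def]
  omega

theorem ind_of_not_isLink (s : net.State) {i j : net.Node} (hl : ¬ net.IsLink i j) :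
    net.ind s i j = 0 :=
  dif_neg hl

theorem ind_le_one (s : net.State) (i j : net.Node) : net.ind s i j ≤ 1 := by
  have hb : ∀ b : Bool, b.toNat ≤ 1 := Bool.toNat_le
  unfold ind
  dsimp only
  split_ifs
  · rfl
  · exact mul_le_one' (hb _) (hb _)
  · exact hb _
  · exact zero_le_one

/-- Restricting to actual links matters because independence and the Rayleigh law are assumed only
there; the other terms have indicator `0`. -/
theorem snr_eq_sum_isLink (s : net.State) (h : net.Node → net.Node → ℂ) (j : net.Node) :
    net.snr s h j = net.P / net.σ ^ 2 *
      (∑ i : {i // net.IsLink i j},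
        net.ind s i j * √((net.d i j) ^ (-net.η) * net.a i j) * ‖h i j‖) ^ 2 := by
  rw [snr]
  congr 2
  rw [← Finset.sum_subtype (Finset.univ.filter fun i => net.IsLink i j) (by simp)
    (fun i => (net.ind s i j : ℝ) * √((net.d i j) ^ (-net.η) * net.a i j) * ‖h i j‖)]
  symm
  refine Finset.sum_subset_zero_on_sdiff (fun i hi => ?_) (fun i hi => ?_) fun i _ => by ring
  · simp only [Finset.mem_filter, Finset.mem_univ, true_and] at hi ⊢
    exact (hi.1.trans_le (Fin.le_last j)).ne
  · simp only [Finset.mem_sdiff, Finset.mem_filter, Finset.mem_univ, true_and] at hi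
    simp [ind_of_not_isLink s hi.2]

theorem snr_lt_iff (s : net.State) (h : net.Node → net.Node → ℂ) (j : net.Node) :
    net.snr s h j < net.γ ↔ ∑ i : {i // net.IsLink i j},
      net.ind s i j * √((net.d i j) ^ (-net.η) * net.a i j) * ‖h i j‖ <
        √(net.γ * net.σ ^ 2 / net.P) := by
  have hP := net.P_pos
  have hσ := net.σ_pos
  rw [snr_eq_sum_isLink, Real.lt_sqrt (Finset.sum_nonneg fun i _ => by positivity),
    lt_div_iff₀ hP, div_mul_eq_mul_div, div_lt_iff₀ (by positivity), mul_comm net.P]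

theorem outageIntegrand_eq (s : net.State) (j : net.Node) (t : ℝ) : net.outageIntegrand s j t =
    1 / t * (Complex.exp (-(Complex.I * t * (√(net.γ * net.σ ^ 2 / net.P) : ℂ))) *
      ∏ i : {i // net.IsLink i j}, net.φ i j t ^ net.ind s i j).im := by
  rw [outageIntegrand, Finset.prod_subtype (p := fun i => net.IsLink i j) _ (fun i => by simp [isLink_iff])
    (fun i => net.φ i j t ^ net.ind s i j)]

theorem hasImproperIntegral_outageIntegrand
    {Ω : Type*} [MeasurableSpace Ω] (μ : Measure Ω) [IsProbabilityMeasure μ]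
    (h : net.Node → net.Node → Ω → ℂ)
    (h_indep : iIndepFun (fun (l : net.Link) => h l.1.1 l.1.2) μ)
    (h_rayleigh : ∀ i j, net.IsLink i j →
      HasLaw (fun ω => ‖h i j ω‖) (rayleighMeasure 1) μ) (s : net.State) (j : net.Node) :
    HasImproperIntegral (net.outageIntegrand s j)
      (Real.pi * (1 / 2 - net.outageProb μ h s j)) := by
  let R : {i // net.IsLink i j} → Ω → ℝ := fun i ω => ‖h i j ω‖
  let c : {i // net.IsLink i j} → ℝ := fun i =>
    net.ind s i j * √((net.d i j) ^ (-net.η) * net.a i j)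
  have hlaw : ∀ i, HasLaw (R i) (rayleighMeasure 1) μ := fun i => h_rayleigh i j i.2
  have hR : iIndepFun R μ := by
    -- Links into a fixed `j` embed injectively into all links, so they inherit independence.
    have h1 := h_indep.precomp (g := fun i : {i // net.IsLink i j} => (⟨(i, j), i.2⟩ : net.Link))
      fun a b hab => by simpa [Subtype.ext_iff] using hab
    exact h1.comp (fun _ z => ‖z‖) fun _ => measurable_norm
  have hm : ∀ i, Integrable (R i) μ := by
    intro i
    have h1 := integrable_id_rayleighMeasure_one
    rw [← (hlaw i).map_eq] at h1
    exact (integrable_map_measure aestronglyMeasurable_id (hlaw i).aemeasurable).1 h1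
  have hna : ∀ i y, μ {ω | R i ω = y} = 0 := fun i y => by
    rw [(hlaw i).measure_eq (p := (· = y)) (measurableSet_singleton y)]
    exact rayleighMeasure_singleton 1 y
  have hy : √(net.γ * net.σ ^ 2 / net.P) ≠ 0 := by
    have := net.P_pos
    have := net.σ_pos
    have := net.γ_pos
    positivity
  have key := hasImproperIntegral_gilPelaez_sum_mul hm hR hna c hy
  have hφ : ∀ (i : {i // net.IsLink i j}) (t : ℝ),
      charFun (μ.map fun ω => c i * R i ω) t = net.φ i j t ^ net.ind s i j := by
    intro i t
    -- A silent link contributes the constant `0`, whose characteristic function is `1 = φ ^ 0`;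
    -- this is why a `0`-`1` coefficient becomes an exponent.
    rcases Nat.le_one_iff_eq_zero_or_eq_one.1 (ind_le_one s i j) with h0 | h1
    · simp [c, h0]
    · rw [h1, pow_one, ← net.charFun_map_norm_mul i.2 (hlaw i)]
      simp only [c, R, h1, Nat.cast_one, one_mul, mul_comm]
  simp only [hφ] at key
  have hprob : net.outageProb μ h s j =
      μ.real {ω | ∑ i, c i * R i ω < √(net.γ * net.σ ^ 2 / net.P)} := by
    simp only [outageProb, snr_lt_iff, c, R]
  rw [hprob, funext (outageIntegrand_eq s j)]
  exact key

end MyopicNetwork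

theorem theorem1 (net : MyopicNetwork)
    {Ω : Type*} [MeasurableSpace Ω] (μ : Measure Ω) [IsProbabilityMeasure μ]
    (h : net.Node → net.Node → Ω → ℂ)
    (h_indep : iIndepFun (fun (l : net.Link) => h l.1.1 l.1.2) μ)
    (h_rayleigh : ∀ i j, net.IsLink i j →
      HasLaw (fun ω => ‖h i j ω‖) (rayleighMeasure 1) μ) :
    (∀ i j, net.IsLink i j → ∀ t : ℝ,
      charFun (μ.map fun ω => ‖h i j ω‖ * √((net.d i j) ^ (-net.η) * net.a i j)) t
        = net.φ i j t) ∧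
    (∀ (s : net.State) (j : net.Node), j ≠ 0 →
      ∃ I : ℝ, HasImproperIntegral (net.outageIntegrand s j) I ∧
        net.outageProb μ h s j = 1 / 2 - 1 / Real.pi * I) := by
  refine ⟨fun i j hl t => net.charFun_map_norm_mul hl (h_rayleigh i j hl) t, fun s j _ =>
    ⟨_, MyopicNetwork.hasImproperIntegral_outageIntegrand μ h h_indep h_rayleigh s j, ?_⟩⟩
  field_simp
  ring
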